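/- For $f\in L^2(\mathbb R)$ (complex valued) let $\widehat f\in L^2(\mathbb R)$ be its Fourier transform, normalized so that $\widehat f(\omega)=\frac1{\sqrt{2\pi}}\int_{\mathbb R}f(t)e^{-it\omega}\,dt$ for $f\in L^1(\mathbb R)\cap L^2(\mathbb R)$. For $k\ge 0$ let $$h_k(x)=\frac{1}{\pi^{1/4}\sqrt{2^k k!}}\,H_k(x)e^{-x^2/2},\qquad H_k(x)=(-1)^k e^{x^2}\frac{d^k}{dx^k}e^{-x^2},$$ be the Hermite functions, and let $K_n$ be the orthogonal projection of $L^2(\mathbb R)$ onto the linear span of $h_0,\dots,h_n$. **Theorem.** Let $T_0,\Omega_0\ge 2$ and $\varepsilon_T,\varepsilon_\Omega>0$, and let $f\in L^2(\mathbb R)$ be $\varepsilon_T$-almost time limited to $[-T_0,T_0]$ and $\varepsilon_\Omega$-almost band limited to $[-\Omega_0,\Omega_0]$, that is, $$\int_{|t|>T_0}|f(t)|^2\,dt\le\varepsilon_T^2\|f\|_{L^2(\mathbb R)}^2\quad\text{and}\quad\int_{|\omega|>\Omega_0}|\widehat f(\omega)|^2\,d\omega\le\varepsilon_\Omega^2\|f\|_{L^2(\mathbb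 R)}^2 .$$ Then for every real $T\ge T_0$ and every integer $n\ge\max(2T^2,2\Omega_0^2)$, $$\|f-K_nf\|_{L^2([-T,T])}\le\left(2\varepsilon_T+\varepsilon_\Omega+\frac{34T^3}{\sqrt{2n+1}}\right)\|f\|_{L^2(\mathbb R)} .$$ -/

import Mathlib

noncomputable section

open MeasureTheory

open scoped FourierTransform

/-- The space `L²(ℝ)` of complex-valued square-integrable functions. -/
abbrev L2R : Type := Lp (α := ℝ) ℂ 2 (volume : Measure ℝ)

/-- The Fourier transform on `L²(ℝ)` in the unitary angular-frequency normalization, i.e.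
`(2π)^(-1/2) ∫ f(t) e^{-itω} dt` for integrable `f`.  Here `𝓕` is the Plancherel extension to `L²`
of `ξ ↦ ∫ f(t) e^{-2πitξ} dt`, whence the rescaling. The value is a representative of an
almost-everywhere class. -/
def angularFourier (f : L2R) (ω : ℝ) : ℂ :=
  ((√(2 * Real.pi))⁻¹ : ℝ) * (𝓕 f : L2R) (ω / (2 * Real.pi))

/-- `f` is `ε`-almost time limited to `[-T, T]`. -/
def AlmostTimeLimited (f : L2R) (ε T : ℝ) : Prop :=
  ∫ t in {t : ℝ | T < |t|}, ‖f t‖ ^ 2 ≤ ε ^ 2 * ‖f‖ ^ 2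

/-- `f` is `ε`-almost band limited to `[-Ω, Ω]`. -/
def AlmostBandLimited (f : L2R) (ε Ω : ℝ) : Prop :=
  ∫ ω in {ω : ℝ | Ω < |ω|}, ‖angularFourier f ω‖ ^ 2 ≤ ε ^ 2 * ‖f‖ ^ 2

/-- The physicists' Hermite polynomial `H_k(x) = (-1)^k e^{x²} (d/dx)^k e^{-x²}`, as a function. -/
def physHermite (k : ℕ) (x : ℝ) : ℝ :=
  (-1) ^ k * Real.exp (x ^ 2) * iteratedDeriv k (fun y : ℝ => Real.exp (-y ^ 2)) x

/-- The `L²`-normalized Hermite function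
`h_k(x) = π^(-1/4) (2^k k!)^(-1/2) H_k(x) e^{-x²/2}`. -/
def hermiteFun (k : ℕ) (x : ℝ) : ℝ :=
  1 / (Real.pi ^ (1 / 4 : ℝ) * √(2 ^ k * (k.factorial : ℝ))) *
    physHermite k x * Real.exp (-x ^ 2 / 2)

theorem iteratedDeriv_gauss_eq (k : ℕ) : ∃ p : Polynomial ℝ,
    iteratedDeriv k (fun y : ℝ => Real.exp (-y ^ 2)) =
      fun x => p.eval x * Real.exp (-x ^ 2) := by
  induction k with
  | zero => exact ⟨1, by simp⟩
  | succ k ih =>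
    obtain ⟨p, hp⟩ := ih
    refine ⟨p.derivative - 2 * Polynomial.X * p, ?_⟩
    rw [iteratedDeriv_succ, hp]
    funext x
    have h1 : HasDerivAt (fun x : ℝ => Real.exp (-x ^ 2)) (Real.exp (-x ^ 2) * (-(2 * x))) x := by
      simpa using ((hasDerivAt_pow 2 x).neg).exp
    refine ((p.hasDerivAt x).mul h1).deriv.trans ?_
    simp
    ring

theorem hermiteFun_eq (k : ℕ) : ∃ p : Polynomial ℝ,
    hermiteFun k = fun x => p.eval x * Real.exp (-x ^ 2 / 2) := by
  obtain ⟨p, hp⟩ := iteratedDeriv_gauss_eq k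
  refine ⟨Polynomial.C (1 / (Real.pi ^ (1 / 4 : ℝ) * √(2 ^ k * (k.factorial : ℝ))) *
    (-1) ^ k) * p, ?_⟩
  funext x
  have h : Real.exp (x ^ 2) * Real.exp (-x ^ 2) = 1 := by
    rw [← Real.exp_add]; simp
  rw [hermiteFun, physHermite, hp, Polynomial.eval_mul, Polynomial.eval_C]
  linear_combination (1 / (Real.pi ^ (1 / 4 : ℝ) * √(2 ^ k * (k.factorial : ℝ))) *
    (-1) ^ k * p.eval x * Real.exp (-x ^ 2 / 2)) * h

theorem integrable_poly_gauss (p : Polynomial ℝ) :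
    Integrable (fun x : ℝ => p.eval x * Real.exp (-x ^ 2)) := by
  induction p using Polynomial.induction_on' with
  | add p q hp hq =>
    refine (hp.add hq).congr (Filter.Eventually.of_forall fun x => ?_)
    simp [add_mul]
  | monomial n a =>
    have h := integrable_rpow_mul_exp_neg_mul_sq (b := 1) one_pos (s := (n : ℝ))
      (by have : (0 : ℝ) ≤ n := n.cast_nonneg
          linarith)
    simpa [mul_assoc] using h.const_mul a

theorem memLp_hermiteFun (k : ℕ) :
    MemLp (fun x : ℝ => (hermiteFun k x : ℂ)) 2 (volume : Measure ℝ) := by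
  obtain ⟨p, hp⟩ := hermiteFun_eq k
  have hc : Continuous (hermiteFun k) := by
    rw [hp]; fun_prop
  have h : MemLp (hermiteFun k) 2 (volume : Measure ℝ) := by
    rw [memLp_two_iff_integrable_sq hc.aestronglyMeasurable]
    refine (integrable_poly_gauss (p ^ 2)).congr (Filter.Eventually.of_forall fun x => ?_)
    simp only [hp, Polynomial.eval_pow, mul_pow, ← Real.exp_nat_mul]
    congr 2
    push_cast
    ring
  exact h.ofReal

/-- The Hermite function `h_k` as an element of `L²(ℝ)`. -/
def hermiteL2 (k : ℕ) : L2R := (memLp_hermiteFun k).toLp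

/-- The linear span of `h_0, …, h_n` in `L²(ℝ)`. -/
def hermiteSpan (n : ℕ) : Submodule ℂ L2R :=
  Submodule.span ℂ (hermiteL2 '' Set.Iic n)

instance (n : ℕ) : FiniteDimensional ℂ (hermiteSpan n) :=
  FiniteDimensional.span_of_finite ℂ ((Set.finite_Iic n).image hermiteL2)

/-- The orthogonal projection `K_n` of `L²(ℝ)` onto the span of `h_0, …, h_n`. -/
def hermiteProj (n : ℕ) : L2R →L[ℂ] L2R := (hermiteSpan n).starProjection

end

/-!
The proof works in phase space, with the short-time Fourier transform `V f` for a Gaussian window.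
Three facts about `V` carry the argument.

* The Moyal identity: the energy of `V f` over the time-frequency plane is a constant multiple of
  `‖f‖²` (`lintegral_gabor_univ`).
* Almost time limitation of `f` makes `V f` small on `{|s| > P}` for `P > T₀`, up to a relative
  error of order `(P - T₀)⁻²`, because the energy density of `V f` in `s` is `|f|²` convolved with a
  Gaussian (`lintegral_gabor_tail`). Since the Fourier transform rotates the phase plane
  (`norm_gabor_angularFourier`), almost band limitation does the same on `{|η| > P}`.
* A Gaussian wave packet at `(s, η)` has a Poisson distribution of parameter `(s² + η²)/2` over the
  Hermite functions (`norm_inner_hermiteL2_gaborAtom_sq`). So for `s² + η² ≤ 3n/2` it lies in the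
  range of `K_n` up to an exponentially small error
  (`norm_gaborAtom_sub_hermiteProj_sq_le`), and `V (f - K_n f)` is exponentially small there.

Take the square `[-P, P]²` with `P` slightly less than `√(3n)/2`. Both `T₀` and `Ω₀` are at most
`√(n/2)`, so `P` exceeds them by a multiple of `√n`. On the square `V (f - K_n f)` is negligible;
off the square `V f` has relative energy at most `εT² + εΩ² + O(1/n)`. As `‖f - K_n f‖²` is the
inner product of `f` and `f - K_n f`, hence up to the constant that of `V f` and `V (f - K_n f)`,
it is at most `(εT² + εΩ² + O(1/n)) ‖f‖²` (`norm_sub_hermiteProj_sq_le`). This bounds the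
approximation error on the whole line, and the `O(1/n)` term is below the square of
`34 T³ / √(2n+1)`.
-/

noncomputable section

open MeasureTheory

open scoped FourierTransform ENNReal

/-! ### The Fourier integral and Plancherel's theorem on `L¹ ∩ L²` -/

open scoped ContDiff in
/-- On `L¹ ∩ L²` the Plancherel extension `𝓕` is given by the Fourier integral: both sides
are locally integrable and define the same tempered distribution. -/
theorem coeFn_fourier_toLp {F : ℝ → ℂ} (h1 : Integrable F) (h2 : MemLp F 2 volume) :
    ((𝓕 (h2.toLp F) : L2R) : ℝ → ℂ) =ᵐ[volume] 𝓕 F := by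
  have hcont : Continuous (𝓕 F) :=
    VectorFourier.fourierIntegral_continuous Real.continuous_fourierChar
      (by exact continuous_inner) h1
  refine ae_eq_of_integral_contDiff_smul_eq
    ((Lp.memLp _).locallyIntegrable (by norm_num)) hcont.locallyIntegrable fun g hg hgc => ?_
  have hg₁ : HasCompactSupport (Complex.ofRealCLM ∘ g) := hgc.comp_left rfl
  have hg₂ : ContDiff ℝ ∞ (Complex.ofRealCLM ∘ g) := by fun_prop
  set φ : SchwartzMap ℝ ℂ := hg₁.toSchwartzMap hg₂ with hφ
  have hφg : ∀ x, φ x = (g x : ℂ) := fun x => rfl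
  have key := congrArg (fun D : TemperedDistribution ℝ ℂ => D φ)
    (Lp.fourier_toTemperedDistribution_eq (h2.toLp F))
  simp only [TemperedDistribution.fourier_apply, Lp.toTemperedDistribution_apply] at key
  have e1 : ∫ x, g x • ((𝓕 (h2.toLp F) : L2R) : ℝ → ℂ) x
      = ∫ x, φ x • ((𝓕 (h2.toLp F) : L2R) : ℝ → ℂ) x := by
    refine integral_congr_ae (Filter.Eventually.of_forall fun x => ?_)
    simp [hφg]
  have e2 : ∫ x, g x • 𝓕 F x = ∫ x, φ x • 𝓕 F x := by
    refine integral_congr_ae (Filter.Eventually.of_forall fun x => ?_)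
    simp [hφg]
  rw [e1, e2, ← key]
  have e3 : ∫ x, (𝓕 φ) x • (h2.toLp F) x = ∫ x, (𝓕 φ) x • F x := by
    refine integral_congr_ae ?_
    filter_upwards [h2.coeFn_toLp] with x hx
    rw [hx]
  rw [e3, SchwartzMap.fourier_coe]
  have h := VectorFourier.integral_fourierIntegral_smul_eq_flip (L := innerₗ ℝ)
    (μ := volume) (ν := volume) Real.continuous_fourierChar
    (by exact continuous_inner) φ.integrable h1
  rw [flip_innerₗ] at h
  exact h

theorem lintegral_enorm_sq_coeFn (u : L2R) : ∫⁻ x, ‖u x‖ₑ ^ 2 = ‖u‖ₑ ^ 2 := by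
  rw [Lp.enorm_def, eLpNorm_eq_lintegral_rpow_enorm_toReal (by norm_num) (by norm_num)]
  simp only [ENNReal.toReal_ofNat, ENNReal.rpow_ofNat]
  rw [← ENNReal.rpow_natCast, ← ENNReal.rpow_mul]
  norm_num

theorem lintegral_enorm_sq_fourier {F : ℝ → ℂ} (h1 : Integrable F) (h2 : MemLp F 2 volume) :
    ∫⁻ ξ, ‖𝓕 F ξ‖ₑ ^ 2 = ∫⁻ x, ‖F x‖ₑ ^ 2 := by
  have a1 : ∫⁻ ξ, ‖𝓕 F ξ‖ₑ ^ 2 = ∫⁻ ξ, ‖(𝓕 (h2.toLp F) : L2R) ξ‖ₑ ^ 2 := by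
    refine lintegral_congr_ae ?_
    filter_upwards [coeFn_fourier_toLp h1 h2] with x hx
    rw [hx]
  have a2 : ∫⁻ x, ‖F x‖ₑ ^ 2 = ∫⁻ x, ‖(h2.toLp F) x‖ₑ ^ 2 := by
    refine lintegral_congr_ae ?_
    filter_upwards [h2.coeFn_toLp] with x hx
    rw [hx]
  rw [a1, a2, lintegral_enorm_sq_coeFn, lintegral_enorm_sq_coeFn, ← ofReal_norm, ← ofReal_norm,
    Lp.norm_fourier_eq]

/-! ### Energy of the short-time Fourier transform -/

/-- The short-time Fourier transform of `u` with the unnormalized Gaussian window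
`e^{-(x-s)²/2}`, at time `s` and angular frequency `η`. It is defined on functions rather than on
`L²` classes, so that it applies to `angularFourier f` as well. -/
def gabor (u : ℝ → ℂ) (s η : ℝ) : ℂ :=
  ∫ x, (Real.exp (-(x - s) ^ 2 / 2) : ℂ) * Complex.exp (-(η * x) * Complex.I) * u x

theorem memLp_gauss_window (s : ℝ) :
    MemLp (fun x : ℝ => (Real.exp (-(x - s) ^ 2 / 2) : ℂ)) 2 volume := by
  have hc : Continuous fun x : ℝ => Real.exp (-(x - s) ^ 2 / 2) := by fun_prop
  have h : MemLp (fun x : ℝ => Real.exp (-(x - s) ^ 2 / 2)) 2 volume := by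
    rw [memLp_two_iff_integrable_sq hc.aestronglyMeasurable]
    refine (((integrable_poly_gauss 1).comp_sub_right s)).congr
      (Filter.Eventually.of_forall fun x => ?_)
    simp only [Polynomial.eval_one, one_mul, ← Real.exp_nat_mul]
    congr 1
    push_cast
    ring
  exact h.ofReal

theorem gauss_window_le_one (s x : ℝ) : ‖(Real.exp (-(x - s) ^ 2 / 2) : ℂ)‖ ≤ 1 := by
  rw [Complex.norm_real, Real.norm_eq_abs, Real.abs_exp, Real.exp_le_one_iff]
  nlinarith [sq_nonneg (x - s)]

theorem integrable_window_mul {u : ℝ → ℂ} (hu : MemLp u 2 volume) (s : ℝ) :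
    Integrable fun x => (Real.exp (-(x - s) ^ 2 / 2) : ℂ) * u x :=
  (memLp_gauss_window s).integrable_mul hu

theorem memLp_window_mul {u : ℝ → ℂ} (hu : MemLp u 2 volume) (s : ℝ) :
    MemLp (fun x => (Real.exp (-(x - s) ^ 2 / 2) : ℂ) * u x) 2 volume := by
  refine hu.of_le ?_ (Filter.Eventually.of_forall fun x => ?_)
  · exact (memLp_gauss_window s).1.mul hu.1
  · rw [norm_mul]
    exact mul_le_of_le_one_left (norm_nonneg _) (gauss_window_le_one s x)

theorem gabor_eq_fourier (u : ℝ → ℂ) (s η : ℝ) :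
    gabor u s η =
      𝓕 (fun x => (Real.exp (-(x - s) ^ 2 / 2) : ℂ) * u x) (η / (2 * Real.pi)) := by
  rw [Real.fourier_real_eq_integral_exp_smul, gabor]
  congr 1
  ext x
  have : Complex.exp (-(η * x) * Complex.I)
      = Complex.exp (((-2 * Real.pi * x * (η / (2 * Real.pi)) : ℝ) : ℂ) * Complex.I) := by
    congr 2
    have : -2 * Real.pi * x * (η / (2 * Real.pi)) = -(η * x) := by
      field_simp [Real.pi_ne_zero]
    rw [this]
    push_cast
    ring
  rw [this, smul_eq_mul]
  ring

theorem lintegral_comp_div_two_pi (g : ℝ → ℝ≥0∞) :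
    ∫⁻ x, g (x / (2 * Real.pi)) = ENNReal.ofReal (2 * Real.pi) * ∫⁻ x, g x := by
  have h2 : (2 * Real.pi) ≠ 0 := by positivity
  have hm := Real.map_volume_mul_right (inv_ne_zero h2)
  rw [inv_inv, abs_of_pos (by positivity)] at hm
  have e : MeasurableEmbedding fun x : ℝ => x * (2 * Real.pi)⁻¹ :=
    (Homeomorph.mulRight₀ _ (inv_ne_zero h2)).measurableEmbedding
  have := e.lintegral_map g (μ := volume)
  rw [hm, lintegral_smul_measure] at this
  simpa [div_eq_mul_inv] using this.symm

theorem enorm_gauss_sq (s x : ℝ) : ‖(Real.exp (-(x - s) ^ 2 / 2) : ℂ)‖ₑ ^ 2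
    = ENNReal.ofReal (Real.exp (-(x - s) ^ 2)) := by
  rw [← ofReal_norm, Complex.norm_real, Real.norm_eq_abs, Real.abs_exp,
    ← ENNReal.ofReal_pow (Real.exp_pos _).le, ← Real.exp_nat_mul]
  congr 2
  push_cast
  ring

/-- Plancherel in the frequency variable, for a fixed position of the window. -/
theorem lintegral_gabor_snd {u : ℝ → ℂ} (hu : MemLp u 2 volume) (s : ℝ) :
    ∫⁻ η, ‖gabor u s η‖ₑ ^ 2 = ENNReal.ofReal (2 * Real.pi) *
      ∫⁻ x, ENNReal.ofReal (Real.exp (-(x - s) ^ 2)) * ‖u x‖ₑ ^ 2 := by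
  simp_rw [gabor_eq_fourier]
  rw [lintegral_comp_div_two_pi
    fun η => ‖𝓕 (fun x => (Real.exp (-(x - s) ^ 2 / 2) : ℂ) * u x) η‖ₑ ^ 2,
    lintegral_enorm_sq_fourier (integrable_window_mul hu s) (memLp_window_mul hu s)]
  congr 2
  ext x
  rw [enorm_mul, mul_pow, enorm_gauss_sq]

/-- The energy of the short-time Fourier transform over the strip `S × ℝ` is the energy of `u`
weighted by the convolution of the indicator of `S` with a Gaussian. -/
theorem lintegral_gabor {u : ℝ → ℂ} (hu : MemLp u 2 volume) (S : Set ℝ) :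
    ∫⁻ s in S, ∫⁻ η, ‖gabor u s η‖ₑ ^ 2 = ENNReal.ofReal (2 * Real.pi) *
      ∫⁻ x, (∫⁻ s in S, ENNReal.ofReal (Real.exp (-(s - x) ^ 2))) * ‖u x‖ₑ ^ 2 := by
  simp_rw [lintegral_gabor_snd hu]
  rw [lintegral_const_mul' _ _ ENNReal.ofReal_ne_top, lintegral_lintegral_swap]
  · congr 2
    ext x
    rw [lintegral_mul_const']
    · congr 2
      ext s
      rw [← neg_sub x s, neg_sq]
    · exact ENNReal.pow_ne_top enorm_ne_top
  · have h : Measurable fun z : ℝ × ℝ => ENNReal.ofReal (Real.exp (-(z.2 - z.1) ^ 2)) := by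
      fun_prop
    exact h.aemeasurable.mul (hu.1.enorm.pow_const 2).comp_snd

theorem lintegral_gauss (x : ℝ) :
    ∫⁻ s, ENNReal.ofReal (Real.exp (-(s - x) ^ 2)) = ENNReal.ofReal √Real.pi := by
  rw [← ofReal_integral_eq_lintegral_ofReal]
  · rw [integral_sub_right_eq_self (fun s => Real.exp (-s ^ 2)) x]
    have := integral_gaussian 1
    simp only [neg_mul, one_mul, div_one] at this
    rw [this]
  · simpa using (integrable_poly_gauss 1).comp_sub_right x
  · exact Filter.Eventually.of_forall fun s => (Real.exp_pos _).le

theorem integral_sq_mul_gauss : ∫ s : ℝ, s ^ 2 * Real.exp (-s ^ 2) = √Real.pi / 2 := by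
  have h0 : ∫ s : ℝ, Real.exp (-s ^ 2) = √Real.pi := by
    simpa using integral_gaussian 1
  have i2 : Integrable fun s : ℝ => s ^ 2 * Real.exp (-s ^ 2) := by
    simpa only [Polynomial.eval_monomial, one_mul] using
      integrable_poly_gauss (Polynomial.monomial 2 1)
  have i1 : Integrable fun s : ℝ => s * Real.exp (-s ^ 2) := by
    simpa using integrable_poly_gauss (Polynomial.X)
  have i0 : Integrable fun s : ℝ => Real.exp (-s ^ 2) := by
    simpa using integrable_poly_gauss 1
  have := integral_mul_deriv_eq_deriv_mul_of_integrable (u := fun s : ℝ => s)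
    (v := fun s => Real.exp (-s ^ 2)) (u' := fun _ => 1)
    (v' := fun s => Real.exp (-s ^ 2) * (-(2 * s)))
    (fun x _ => hasDerivAt_id x)
    (fun x _ => by simpa using ((hasDerivAt_pow 2 x).neg).exp)
    ((i2.const_mul (-2)).congr (Filter.Eventually.of_forall fun s => by simp; ring))
    (i0.congr (Filter.Eventually.of_forall fun s => by simp))
    (i1.congr (Filter.Eventually.of_forall fun s => by simp))
  have e : ∫ x : ℝ, x * (Real.exp (-x ^ 2) * (-(2 * x)))
      = -2 * ∫ s : ℝ, s ^ 2 * Real.exp (-s ^ 2) := by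
    rw [← integral_const_mul]
    congr 1
    ext s
    ring
  rw [e] at this
  simp only [one_mul, h0] at this
  linarith

/-- Chebyshev's inequality for the Gaussian `e^{-(s-x)²}`, whose variance is `1/2`. -/
theorem lintegral_gauss_tail {P T x : ℝ} (hPT : T < P) (hx : |x| ≤ T) :
    ∫⁻ s in {s : ℝ | P < |s|}, ENNReal.ofReal (Real.exp (-(s - x) ^ 2)) ≤
      ENNReal.ofReal (√Real.pi * (1 / (2 * (P - T) ^ 2))) := by
  have hd : 0 < P - T := sub_pos.2 hPT
  have hms : MeasurableSet {s : ℝ | P < |s|} := measurableSet_lt measurable_const measurable_norm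
  calc ∫⁻ s in {s : ℝ | P < |s|}, ENNReal.ofReal (Real.exp (-(s - x) ^ 2))
      ≤ ∫⁻ s in {s : ℝ | P < |s|},
          ENNReal.ofReal (1 / (P - T) ^ 2 * ((s - x) ^ 2 * Real.exp (-(s - x) ^ 2))) := by
        refine setLIntegral_mono' hms fun s hs => ENNReal.ofReal_le_ofReal ?_
        have h1 : P - T ≤ |s - x| := by
          have := abs_sub_abs_le_abs_sub s x
          have hs' : P < |s| := hs
          linarith
        have h2 : (P - T) ^ 2 ≤ (s - x) ^ 2 := by
          rw [← sq_abs (s - x)]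
          exact pow_le_pow_left₀ hd.le h1 2
        rw [← mul_assoc]
        refine le_mul_of_one_le_left (Real.exp_pos _).le ?_
        rw [one_div, inv_mul_eq_div, one_le_div (by positivity)]
        exact h2
    _ ≤ ∫⁻ s, ENNReal.ofReal (1 / (P - T) ^ 2 * ((s - x) ^ 2 * Real.exp (-(s - x) ^ 2))) :=
        setLIntegral_le_lintegral _ _
    _ = ENNReal.ofReal (√Real.pi * (1 / (2 * (P - T) ^ 2))) := by
        rw [← ofReal_integral_eq_lintegral_ofReal]
        · rw [integral_const_mul,
            integral_sub_right_eq_self (fun s => s ^ 2 * Real.exp (-s ^ 2)) x,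
            integral_sq_mul_gauss]
          congr 1
          field_simp
        · have : Integrable fun s : ℝ => s ^ 2 * Real.exp (-s ^ 2) := by
            simpa only [Polynomial.eval_monomial, one_mul] using
      integrable_poly_gauss (Polynomial.monomial 2 1)
          exact (this.comp_sub_right x).const_mul _
        · exact Filter.Eventually.of_forall fun s => by positivity

/-- The Moyal identity for the Gaussian window. -/
theorem lintegral_gabor_univ {u : ℝ → ℂ} (hu : MemLp u 2 volume) :
    ∫⁻ s, ∫⁻ η, ‖gabor u s η‖ₑ ^ 2 =
      ENNReal.ofReal (2 * Real.pi * √Real.pi) * ∫⁻ x, ‖u x‖ₑ ^ 2 := by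
  have := lintegral_gabor hu Set.univ
  simp only [Measure.restrict_univ, lintegral_gauss] at this
  rw [this, lintegral_const_mul' _ _ ENNReal.ofReal_ne_top, ← mul_assoc,
    ENNReal.ofReal_mul (p := 2 * Real.pi) (by positivity)]

/-- Outside the strip `|s| ≤ P` the short-time Fourier transform of `u` carries no more energy
than `u` outside `[-T, T]`, up to a fraction of order `(P - T)⁻²`. -/
theorem lintegral_gabor_tail {u : ℝ → ℂ} (hu : MemLp u 2 volume) {P T : ℝ} (hPT : T < P) :
    ∫⁻ s in {s : ℝ | P < |s|}, ∫⁻ η, ‖gabor u s η‖ₑ ^ 2 ≤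
      ENNReal.ofReal (2 * Real.pi * √Real.pi) * ((∫⁻ x in {x : ℝ | T < |x|}, ‖u x‖ₑ ^ 2) +
        ENNReal.ofReal (1 / (2 * (P - T) ^ 2)) * ∫⁻ x, ‖u x‖ₑ ^ 2) := by
  have hms : MeasurableSet {s : ℝ | T < |s|} := measurableSet_lt measurable_const measurable_norm
  rw [lintegral_gabor hu, ENNReal.ofReal_mul (p := 2 * Real.pi) (by positivity), mul_assoc]
  gcongr ENNReal.ofReal (2 * Real.pi) * ?_
  rw [← lintegral_indicator hms, ← lintegral_const_mul' _ _ ENNReal.ofReal_ne_top, mul_add,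
    ← lintegral_const_mul' _ _ ENNReal.ofReal_ne_top,
    ← lintegral_const_mul' _ _ ENNReal.ofReal_ne_top, ← lintegral_add_right']
  · refine lintegral_mono fun x => ?_
    -- For `|x| > T` the whole Gaussian mass bounds the weight, otherwise only its tail does.
    by_cases hx : T < |x|
    · rw [Set.indicator_of_mem (by exact hx)]
      refine le_add_right ?_
      gcongr
      exact (setLIntegral_le_lintegral _ _).trans_eq (lintegral_gauss x)
    · refine le_add_left ?_
      rw [← mul_assoc, ← ENNReal.ofReal_mul (by positivity)]
      gcongr
      exact lintegral_gauss_tail hPT (not_lt.1 hx)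
  · exact ((hu.1.enorm.pow_const 2).const_mul _).const_mul _

/-! ### Wave packets and time-frequency duality -/

/-- The Gaussian wave packet (unnormalized coherent state) centred at time `s` and angular
frequency `η`. -/
def gaborAtom (s η x : ℝ) : ℂ :=
  (Real.exp (-(x - s) ^ 2 / 2) : ℂ) * Complex.exp (η * x * Complex.I)

theorem norm_exp_ofReal_mul_mul_I (a x : ℝ) : ‖Complex.exp (a * x * Complex.I)‖ = 1 := by
  rw [← Complex.ofReal_mul, Complex.norm_exp_ofReal_mul_I]

theorem continuous_gaborAtom (s η : ℝ) : Continuous (gaborAtom s η) := by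
  unfold gaborAtom
  fun_prop

theorem memLp_gaborAtom (s η : ℝ) : MemLp (gaborAtom s η) 2 volume := by
  refine (memLp_gauss_window s).of_le (continuous_gaborAtom s η).aestronglyMeasurable
    (Filter.Eventually.of_forall fun x => ?_)
  rw [gaborAtom, norm_mul, norm_exp_ofReal_mul_mul_I, mul_one]

theorem integrable_gaborAtom (s η : ℝ) : Integrable (gaborAtom s η) := by
  have h : Integrable (fun x : ℝ => Real.exp (-(x - s) ^ 2 / 2)) := by
    have := (integrable_exp_neg_mul_sq (b := 1 / 2) (by norm_num)).comp_sub_right s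
    refine this.congr (Filter.Eventually.of_forall fun x => ?_)
    simp only
    congr 1
    ring
  refine h.mono (continuous_gaborAtom s η).aestronglyMeasurable
    (Filter.Eventually.of_forall fun x => ?_)
  rw [gaborAtom, norm_mul, norm_exp_ofReal_mul_mul_I, mul_one, Complex.norm_real]

theorem conj_gaborAtom (s η x : ℝ) : (starRingEnd ℂ) (gaborAtom s η x) =
    (Real.exp (-(x - s) ^ 2 / 2) : ℂ) * Complex.exp (-(η * x) * Complex.I) := by
  rw [gaborAtom, map_mul, Complex.conj_ofReal, ← Complex.exp_conj]
  simp

theorem gabor_eq_inner (f : L2R) (s η : ℝ) :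
    gabor f s η = inner ℂ ((memLp_gaborAtom s η).toLp) f := by
  rw [L2.inner_def, gabor]
  refine integral_congr_ae ?_
  filter_upwards [(memLp_gaborAtom s η).coeFn_toLp] with x hx
  rw [hx, RCLike.inner_apply, ← conj_gaborAtom, mul_comm]

/-- The Fourier transform rotates phase space by a right angle: `(s, η)` goes to `(η, -s)`. -/
theorem fourier_gaborAtom (s η ξ : ℝ) : 𝓕 (gaborAtom s η) ξ =
    √(2 * Real.pi) * Complex.exp (s * η * Complex.I) *
      gaborAtom η (-s) (2 * Real.pi * ξ) := by
  rw [Real.fourier_real_eq_integral_exp_smul]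
  have e : ∀ x : ℝ, Complex.exp (((-2 * Real.pi * x * ξ : ℝ) : ℂ) * Complex.I) •
      gaborAtom s η x = Complex.exp (-(1 / 2) * x ^ 2 +
        (s + (η - 2 * Real.pi * ξ) * Complex.I) * x + -(s ^ 2 / 2)) := by
    intro x
    rw [gaborAtom, Complex.ofReal_exp, smul_eq_mul, ← Complex.exp_add, ← Complex.exp_add]
    congr 1
    push_cast
    ring
  simp_rw [e]
  rw [integral_cexp_quadratic (by norm_num), gaborAtom]
  have h2 : ((Real.pi : ℂ) / -(-(1 / 2))) ^ (1 / 2 : ℂ) = (√(2 * Real.pi) : ℂ) := by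
    rw [Real.sqrt_eq_rpow, Complex.ofReal_cpow (by positivity)]
    congr 1
    · push_cast; ring
    · push_cast; rfl
  rw [h2, mul_assoc (√(2 * Real.pi) : ℂ), Complex.ofReal_exp, ← Complex.exp_add, ← Complex.exp_add]
  congr 2
  push_cast
  ring_nf
  rw [Complex.I_sq]
  ring

/-- Covariance of the short-time Fourier transform: passing to `angularFourier f` exchanges time
and frequency. Hence band limitation of `f` is time limitation of its transform. -/
theorem norm_gabor_angularFourier (f : L2R) (s η : ℝ) :
    ‖gabor f s η‖ = ‖gabor (angularFourier f) η (-s)‖ := by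
  have h2 : (0 : ℝ) < 2 * Real.pi := by positivity
  rw [gabor_eq_inner, ← Lp.inner_fourier_eq, L2.inner_def]
  have e1 : ∫ ξ, inner ℂ ((𝓕 (memLp_gaborAtom s η).toLp : L2R) ξ) ((𝓕 f : L2R) ξ) =
      ∫ ξ, (√(2 * Real.pi) * Complex.exp (-(s * η) * Complex.I)) *
        ((starRingEnd ℂ) (gaborAtom η (-s) (2 * Real.pi * ξ)) * (𝓕 f : L2R) ξ) := by
    refine integral_congr_ae ?_
    filter_upwards [coeFn_fourier_toLp (integrable_gaborAtom s η) (memLp_gaborAtom s η)]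
      with ξ hξ
    rw [hξ, RCLike.inner_apply, fourier_gaborAtom, map_mul, map_mul, Complex.conj_ofReal,
      ← Complex.exp_conj]
    have : (starRingEnd ℂ) (s * η * Complex.I) = -(s * η) * Complex.I := by simp
    rw [this]
    ring
  have e2 : ∫ ξ, (starRingEnd ℂ) (gaborAtom η (-s) (2 * Real.pi * ξ)) * (𝓕 f : L2R) ξ =
      ((2 * Real.pi)⁻¹ : ℝ) *
        ∫ ω, (starRingEnd ℂ) (gaborAtom η (-s) ω) * (𝓕 f : L2R) (ω / (2 * Real.pi)) := by
    have := Measure.integral_comp_mul_left (fun ω =>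
      (starRingEnd ℂ) (gaborAtom η (-s) ω) * (𝓕 f : L2R) (ω / (2 * Real.pi))) (2 * Real.pi)
    rw [abs_of_pos (by positivity), Complex.real_smul] at this
    rw [← this]
    congr 1
    ext ξ
    rw [mul_div_cancel_left₀ _ h2.ne']
  have e3 : gabor (angularFourier f) η (-s) = ((√(2 * Real.pi))⁻¹ : ℝ) *
      ∫ ω, (starRingEnd ℂ) (gaborAtom η (-s) ω) * (𝓕 f : L2R) (ω / (2 * Real.pi)) := by
    rw [gabor, ← integral_const_mul]
    congr 1
    ext ω
    rw [conj_gaborAtom, angularFourier]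
    ring
  have hs : √(2 * Real.pi) * (2 * Real.pi)⁻¹ = (√(2 * Real.pi))⁻¹ := by
    have h4 : √(2 * Real.pi) ≠ 0 := (Real.sqrt_pos.2 h2).ne'
    have h3 := Real.mul_self_sqrt h2.le
    nth_rewrite 2 [← h3]
    rw [mul_inv, ← mul_assoc, mul_inv_cancel₀ h4, one_mul]
  rw [e1, integral_const_mul, e2, e3]
  have h1 : ‖Complex.exp (-(s * η) * Complex.I)‖ = 1 := by
    have := norm_exp_ofReal_mul_mul_I (-s) η
    simpa using this
  rw [norm_mul, norm_mul, norm_mul, norm_mul, h1, mul_one, ← mul_assoc]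
  congr 1
  rw [← norm_mul, ← Complex.ofReal_mul, hs]

theorem lintegral_angularFourier (f : L2R) : ∫⁻ ω, ‖angularFourier f ω‖ₑ ^ 2 = ‖f‖ₑ ^ 2 := by
  have h2 : (0 : ℝ) < 2 * Real.pi := by positivity
  have e : ∀ ω, ‖angularFourier f ω‖ₑ ^ 2 =
      ENNReal.ofReal ((2 * Real.pi)⁻¹) * ‖(𝓕 f : L2R) (ω / (2 * Real.pi))‖ₑ ^ 2 := by
    intro ω
    rw [angularFourier, enorm_mul, mul_pow]
    congr 1
    rw [← ofReal_norm, Complex.norm_real, Real.norm_eq_abs, abs_of_nonneg (by positivity),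
      ← ENNReal.ofReal_pow (by positivity), inv_pow, Real.sq_sqrt h2.le]
  simp_rw [e]
  rw [lintegral_const_mul' _ _ ENNReal.ofReal_ne_top,
    lintegral_comp_div_two_pi fun ξ => ‖(𝓕 f : L2R) ξ‖ₑ ^ 2, ← mul_assoc,
    ← ENNReal.ofReal_mul (by positivity), inv_mul_cancel₀ h2.ne', ENNReal.ofReal_one, one_mul,
    lintegral_enorm_sq_coeFn, ← ofReal_norm, Lp.norm_fourier_eq, ofReal_norm]

theorem memLp_angularFourier (f : L2R) : MemLp (angularFourier f) 2 volume := by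
  have hq : Measure.QuasiMeasurePreserving (fun ω : ℝ => ω / (2 * Real.pi)) volume volume := by
    simpa only [div_eq_inv_mul, smul_eq_mul] using
      Measure.quasiMeasurePreserving_smul (E := ℝ) volume (r := (2 * Real.pi)⁻¹) (by positivity)
  have hm : AEStronglyMeasurable (angularFourier f) volume :=
    ((Lp.aestronglyMeasurable (𝓕 f : L2R)).comp_quasiMeasurePreserving hq).const_mul _
  refine ⟨hm, ?_⟩
  rw [eLpNorm_lt_top_iff_lintegral_rpow_enorm_lt_top (by norm_num) (by norm_num)]
  simp only [ENNReal.toReal_ofNat, ENNReal.rpow_ofNat]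
  rw [lintegral_angularFourier]
  exact ENNReal.pow_lt_top enorm_lt_top

theorem setLIntegral_enorm_sq_eq {u : ℝ → ℂ} (hu : MemLp u 2 volume) (S : Set ℝ) :
    ∫⁻ x in S, ‖u x‖ₑ ^ 2 = ENNReal.ofReal (∫ x in S, ‖u x‖ ^ 2) := by
  have hi : Integrable (fun x => ‖u x‖ ^ 2) volume := (memLp_two_iff_integrable_sq_norm hu.1).1 hu
  rw [ofReal_integral_eq_lintegral_ofReal hi.integrableOn
    (Filter.Eventually.of_forall fun x => by positivity)]
  congr 1
  ext x
  rw [ENNReal.ofReal_pow (norm_nonneg _), ofReal_norm]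

theorem lintegral_gabor_coeFn (f : L2R) :
    ∫⁻ s, ∫⁻ η, ‖gabor f s η‖ₑ ^ 2 =
      ENNReal.ofReal (2 * Real.pi * √Real.pi * ‖f‖ ^ 2) := by
  rw [lintegral_gabor_univ (Lp.memLp f), lintegral_enorm_sq_coeFn,
    ENNReal.ofReal_mul (p := 2 * Real.pi * √Real.pi) (by positivity),
    ENNReal.ofReal_pow (norm_nonneg _), ofReal_norm]

theorem lintegral_gabor_time_tail (f : L2R) {ε P T : ℝ} (hPT : T < P)
    (hf : AlmostTimeLimited f ε T) :
    ∫⁻ s in {s : ℝ | P < |s|}, ∫⁻ η, ‖gabor f s η‖ₑ ^ 2 ≤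
      ENNReal.ofReal (2 * Real.pi * √Real.pi * ((ε ^ 2 + 1 / (2 * (P - T) ^ 2)) * ‖f‖ ^ 2)) := by
  refine (lintegral_gabor_tail (Lp.memLp f) hPT).trans ?_
  rw [ENNReal.ofReal_mul (p := 2 * Real.pi * √Real.pi) (by positivity), add_mul,
    ENNReal.ofReal_add (by positivity) (by positivity),
    ENNReal.ofReal_mul (p := 1 / (2 * (P - T) ^ 2)) (by positivity), lintegral_enorm_sq_coeFn,
    ENNReal.ofReal_pow (norm_nonneg _), ofReal_norm, setLIntegral_enorm_sq_eq (Lp.memLp f)]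
  gcongr
  exact hf

theorem lintegral_gabor_frequency_tail (f : L2R) {ε P Ω : ℝ} (hPΩ : Ω < P)
    (hf : AlmostBandLimited f ε Ω) :
    ∫⁻ η in {η : ℝ | P < |η|}, ∫⁻ s, ‖gabor f s η‖ₑ ^ 2 ≤
      ENNReal.ofReal (2 * Real.pi * √Real.pi * ((ε ^ 2 + 1 / (2 * (P - Ω) ^ 2)) * ‖f‖ ^ 2)) := by
  have e : ∀ η, ∫⁻ s, ‖gabor f s η‖ₑ ^ 2 = ∫⁻ s, ‖gabor (angularFourier f) η s‖ₑ ^ 2 := by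
    intro η
    rw [← lintegral_neg_eq_self fun s => ‖gabor (angularFourier f) η s‖ₑ ^ 2]
    congr 1
    ext s
    rw [← ofReal_norm, norm_gabor_angularFourier, ofReal_norm]
  simp_rw [e]
  refine (lintegral_gabor_tail (memLp_angularFourier f) hPΩ).trans ?_
  rw [ENNReal.ofReal_mul (p := 2 * Real.pi * √Real.pi) (by positivity), add_mul,
    ENNReal.ofReal_add (by positivity) (by positivity),
    ENNReal.ofReal_mul (p := 1 / (2 * (P - Ω) ^ 2)) (by positivity), lintegral_angularFourier,
    ENNReal.ofReal_pow (norm_nonneg _), ofReal_norm,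
    setLIntegral_enorm_sq_eq (memLp_angularFourier f)]
  gcongr
  exact hf

theorem measurable_gabor (f : L2R) : StronglyMeasurable fun z : ℝ × ℝ => gabor f z.1 z.2 := by
  have h1 : StronglyMeasurable fun w : (ℝ × ℝ) × ℝ =>
      (Real.exp (-(w.2 - w.1.1) ^ 2 / 2) : ℂ) *
        Complex.exp (-(w.1.2 * w.2) * Complex.I) * f w.2 := by
    refine StronglyMeasurable.mul (Continuous.stronglyMeasurable (by fun_prop)) ?_
    exact (Lp.stronglyMeasurable f).comp_measurable measurable_snd
  exact h1.integral_prod_right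

/-! ### Hermite polynomials and Gaussian moments -/

open Polynomial in
/-- The polynomial factor `h_k(x) e^{x²/2}` of the normalized Hermite function, with complex
coefficients, given by the raising operator `√(2(k+1)) p_{k+1} = 2x p_k - p_k'`. -/
def hermitePoly : ℕ → Polynomial ℂ
  | 0 => C ((Real.pi ^ (-1 / 4 : ℝ) : ℝ) : ℂ)
  | k + 1 => C (((√(2 * (k + 1 : ℝ)))⁻¹ : ℝ) : ℂ) *
      (2 * X * hermitePoly k - derivative (hermitePoly k))

/-- The functional `P ↦ ∫ P(x) e^{-x² + wx} dx` on polynomials. At `w = 0` it computes inner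
products of Hermite functions, and at `w = s + iη` their inner products with Gaussian wave
packets. -/
def gaussMoment (w : ℂ) (P : Polynomial ℂ) : ℂ :=
  ∫ x : ℝ, P.eval (x : ℂ) * Complex.exp (-x ^ 2 + w * x)

theorem sqrt_two_mul_add_one_ne_zero (k : ℕ) : ((√(2 * (k + 1 : ℝ)) : ℝ) : ℂ) ≠ 0 := by
  have : (0 : ℝ) < √(2 * (k + 1 : ℝ)) := Real.sqrt_pos.2 (by positivity)
  exact_mod_cast this.ne'

open Polynomial in
theorem sqrt_mul_hermitePoly_succ (k : ℕ) :
    C ((√(2 * (k + 1 : ℝ)) : ℝ) : ℂ) * hermitePoly (k + 1) =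
      2 * X * hermitePoly k - derivative (hermitePoly k) := by
  rw [hermitePoly, ← mul_assoc, ← C_mul, Complex.ofReal_inv,
    mul_inv_cancel₀ (sqrt_two_mul_add_one_ne_zero k), C_1, one_mul]

open Polynomial in
/-- The lowering operator `p_{k+1}' = √(2(k+1)) p_k`. -/
theorem derivative_hermitePoly_succ (k : ℕ) :
    derivative (hermitePoly (k + 1)) =
      C ((√(2 * (k + 1 : ℝ)) : ℝ) : ℂ) * hermitePoly k := by
  have hC : ∀ k : ℕ, (C ((√(2 * (k + 1 : ℝ)) : ℝ) : ℂ)) ≠ 0 := fun k => by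
    rw [Ne, C_eq_zero]
    exact sqrt_two_mul_add_one_ne_zero k
  have hsq : ∀ k : ℕ, (C ((√(2 * (k + 1 : ℝ)) : ℝ) : ℂ)) * C ((√(2 * (k + 1 : ℝ)) : ℝ) : ℂ) =
      2 * ((k : ℂ[X]) + 1) := fun k => by
    rw [← C_mul, ← Complex.ofReal_mul, Real.mul_self_sqrt (by positivity)]
    push_cast
    rw [C_mul, C_add, C_1, map_natCast, map_ofNat]
  have h2 : derivative (2 : ℂ[X]) = 0 := derivative_ofNat 2
  induction k with
  | zero =>
    apply mul_left_cancel₀ (hC 0)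
    have h := congrArg derivative (sqrt_mul_hermitePoly_succ 0)
    have h0 : derivative (hermitePoly 0) = 0 := by simp [hermitePoly]
    rw [derivative_C_mul, h0] at h
    rw [h, ← mul_assoc, hsq]
    simp [h0, h2, derivative_mul]
  | succ k ih =>
    apply mul_left_cancel₀ (hC (k + 1))
    have h := congrArg derivative (sqrt_mul_hermitePoly_succ (k + 1))
    have h3 := sqrt_mul_hermitePoly_succ k
    rw [derivative_C_mul] at h
    rw [h, ← mul_assoc, hsq, ih]
    simp only [derivative_sub, derivative_mul, h2, derivative_X, derivative_C, ih]
    push_cast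
    linear_combination C ((√(2 * (k + 1 : ℝ)) : ℝ) : ℂ) * (-h3) + hermitePoly (k + 1) * hsq k

theorem integrable_poly_mul_cexp (P : Polynomial ℂ) (w : ℂ) :
    Integrable fun x : ℝ => P.eval (x : ℂ) * Complex.exp (-x ^ 2 + w * x) := by
  induction P using Polynomial.induction_on' with
  | add p q hp hq =>
    refine (hp.add hq).congr (Filter.Eventually.of_forall fun x => ?_)
    simp [add_mul]
  | monomial n a =>
    have h := (integrable_rpow_mul_exp_neg_mul_sq (b := 1 / 2) (by norm_num) (s := (n : ℝ))
      (by have : (0 : ℝ) ≤ n := n.cast_nonneg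
          linarith)).norm.const_mul (‖a‖ * Real.exp (w.re ^ 2 / 2))
    refine h.mono' (Continuous.aestronglyMeasurable (by fun_prop))
      (Filter.Eventually.of_forall fun x => ?_)
    have hre : (-(x : ℂ) ^ 2 + w * x).re = -x ^ 2 + w.re * x := by
      simp [← Complex.ofReal_pow]
    rw [Polynomial.eval_monomial, norm_mul, norm_mul, Complex.norm_exp, hre, norm_mul,
      Real.rpow_natCast, norm_pow, norm_pow, Complex.norm_real, Real.norm_eq_abs (Real.exp _),
      Real.abs_exp]
    -- Completing the square absorbs the linear exponent into half of the Gaussian decay.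
    have : Real.exp (-x ^ 2 + w.re * x) ≤
        Real.exp (w.re ^ 2 / 2) * Real.exp (-(1 / 2) * x ^ 2) := by
      rw [← Real.exp_add]
      apply Real.exp_le_exp.2
      nlinarith [sq_nonneg (x - w.re)]
    calc _ ≤ ‖a‖ * ‖x‖ ^ n * (Real.exp (w.re ^ 2 / 2) * Real.exp (-(1 / 2) * x ^ 2)) := by
          gcongr
      _ = _ := by ring

theorem gaussMoment_C_mul (w a : ℂ) (P : Polynomial ℂ) :
    gaussMoment w (Polynomial.C a * P) = a * gaussMoment w P := by
  rw [gaussMoment, gaussMoment, ← integral_const_mul]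
  simp [mul_assoc]

theorem gaussMoment_sub (w : ℂ) (P Q : Polynomial ℂ) :
    gaussMoment w (P - Q) = gaussMoment w P - gaussMoment w Q := by
  rw [gaussMoment, gaussMoment, gaussMoment,
    ← integral_sub (integrable_poly_mul_cexp P w) (integrable_poly_mul_cexp Q w)]
  simp [sub_mul]

open Polynomial in
theorem gaussMoment_integration_by_parts (w : ℂ) (P : Polynomial ℂ) :
    gaussMoment w (derivative P - (2 * X - C w) * P) = 0 := by
  have hd : ∀ x : ℝ, HasDerivAt (fun x : ℝ => P.eval (x : ℂ) * Complex.exp (-x ^ 2 + w * x))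
      ((derivative P - (2 * X - C w) * P).eval (x : ℂ) * Complex.exp (-x ^ 2 + w * x)) x := by
    intro x
    have h1 : HasDerivAt (fun z : ℂ => P.eval z * Complex.exp (-z ^ 2 + w * z))
      ((derivative P - (2 * X - C w) * P).eval (x : ℂ) * Complex.exp (-x ^ 2 + w * x)) x := by
      have h2 : HasDerivAt (fun z : ℂ => -z ^ 2 + w * z) (-(2 * x) + w) (x : ℂ) := by
        refine (((hasDerivAt_pow 2 (x : ℂ)).neg).add
          ((hasDerivAt_id (x : ℂ)).const_mul w)).congr_deriv ?_
        simp
      refine ((P.hasDerivAt (x : ℂ)).mul h2.cexp).congr_deriv ?_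
      simp
      ring
    exact h1.comp_ofReal
  exact integral_eq_zero_of_hasDerivAt_of_integrable hd (integrable_poly_mul_cexp _ w)
    (integrable_poly_mul_cexp _ w)

open Polynomial in
/-- The raising operator is adjoint to `Q ↦ Q' + wQ`. -/
theorem gaussMoment_hermitePoly_succ_mul (w : ℂ) (k : ℕ) (Q : Polynomial ℂ) :
    ((√(2 * (k + 1 : ℝ)) : ℝ) : ℂ) * gaussMoment w (hermitePoly (k + 1) * Q) =
      gaussMoment w (hermitePoly k * (derivative Q + C w * Q)) := by
  have h := gaussMoment_integration_by_parts w (hermitePoly k * Q)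
  have e : derivative (hermitePoly k * Q) - (2 * X - C w) * (hermitePoly k * Q) =
      hermitePoly k * (derivative Q + C w * Q) -
        C ((√(2 * (k + 1 : ℝ)) : ℝ) : ℂ) * (hermitePoly (k + 1) * Q) := by
    rw [← mul_assoc (C _), sqrt_mul_hermitePoly_succ, derivative_mul]
    ring
  rw [e, gaussMoment_sub, gaussMoment_C_mul, sub_eq_zero] at h
  exact h.symm

theorem gaussMoment_one (w : ℂ) :
    gaussMoment w 1 = (√Real.pi : ℝ) * Complex.exp (w ^ 2 / 4) := by
  have := integral_cexp_quadratic (b := -1) (by norm_num) w 0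
  simp only [gaussMoment, Polynomial.eval_one, one_mul]
  simp only [neg_mul, one_mul, add_zero, neg_neg, div_one, zero_sub, mul_neg, mul_one] at this
  rw [this, Real.sqrt_eq_rpow, Complex.ofReal_cpow Real.pi_pos.le]
  congr 2
  · push_cast; rfl
  · ring

theorem pi_rpow_neg_quarter_mul_self :
    Real.pi ^ (-1 / 4 : ℝ) * Real.pi ^ (-1 / 4 : ℝ) * √Real.pi = 1 := by
  rw [Real.sqrt_eq_rpow, ← Real.rpow_add Real.pi_pos, ← Real.rpow_add Real.pi_pos]
  norm_num

theorem gaussMoment_hermitePoly_mul (j k : ℕ) :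
    gaussMoment 0 (hermitePoly j * hermitePoly k) = if j = k then 1 else 0 := by
  have hz : gaussMoment 0 0 = 0 := by simp [gaussMoment]
  have step : ∀ j : ℕ, gaussMoment 0 (hermitePoly (j + 1) * hermitePoly 0) = 0 := by
    intro j
    have h := gaussMoment_hermitePoly_succ_mul 0 j (hermitePoly 0)
    have h0 : Polynomial.derivative (hermitePoly 0) = 0 := by simp [hermitePoly]
    rw [h0, Polynomial.C_0, zero_mul, add_zero, mul_zero, hz] at h
    exact (mul_eq_zero.1 h).resolve_left (sqrt_two_mul_add_one_ne_zero j)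
  induction j generalizing k with
  | zero =>
    cases k with
    | zero =>
      have h := gaussMoment_one 0
      have e : hermitePoly 0 * hermitePoly 0 = Polynomial.C
          ((Real.pi ^ (-1 / 4 : ℝ) * Real.pi ^ (-1 / 4 : ℝ) : ℝ) : ℂ) * 1 := by
        rw [hermitePoly, ← Polynomial.C_mul, mul_one, Complex.ofReal_mul]
      rw [e, gaussMoment_C_mul, h]
      simp only [ne_eq, OfNat.ofNat_ne_zero, not_false_eq_true, zero_pow, zero_div,
        Complex.exp_zero, mul_one, if_true]
      exact_mod_cast pi_rpow_neg_quarter_mul_self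
    | succ k =>
      rw [mul_comm, step]
      simp
  | succ j ih =>
    cases k with
    | zero =>
      rw [step]
      simp
    | succ k =>
      have h := gaussMoment_hermitePoly_succ_mul 0 j (hermitePoly (k + 1))
      rw [derivative_hermitePoly_succ, Polynomial.C_0, zero_mul, add_zero, mul_left_comm,
        gaussMoment_C_mul, ih] at h
      by_cases hjk : j = k
      · subst hjk
        simp only [if_true, mul_one] at h ⊢
        exact mul_left_cancel₀ (sqrt_two_mul_add_one_ne_zero j) (h.trans (mul_one _).symm)
      · simp only [hjk, if_false, mul_zero] at h
        simpa [hjk] using (mul_eq_zero.1 h).resolve_left (sqrt_two_mul_add_one_ne_zero j)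

theorem gaussMoment_hermitePoly (w : ℂ) (k : ℕ) :
    ‖gaussMoment w (hermitePoly k)‖ ^ 2 =
      √Real.pi * ‖Complex.exp (w ^ 2 / 4)‖ ^ 2 * ((‖w‖ ^ 2 / 2) ^ k / k.factorial) := by
  induction k with
  | zero =>
    have h : gaussMoment w (hermitePoly 0) =
        ((Real.pi ^ (-1 / 4 : ℝ) * √Real.pi : ℝ) : ℂ) * Complex.exp (w ^ 2 / 4) := by
      rw [hermitePoly, ← mul_one (Polynomial.C _), gaussMoment_C_mul, gaussMoment_one]
      push_cast
      ring
    rw [h, norm_mul, mul_pow, Complex.norm_real, Real.norm_eq_abs, sq_abs]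
    simp only [pow_zero, Nat.factorial_zero, Nat.cast_one, div_one, mul_one]
    congr 1
    linear_combination √Real.pi * pi_rpow_neg_quarter_mul_self
  | succ k ih =>
    have h := gaussMoment_hermitePoly_succ_mul w k 1
    rw [Polynomial.derivative_one, zero_add, mul_one, mul_one, mul_comm (hermitePoly k),
      gaussMoment_C_mul] at h
    have h2 := congrArg (fun z : ℂ => ‖z‖ ^ 2) h
    simp only [norm_mul, mul_pow, Complex.norm_real, Real.norm_eq_abs, sq_abs] at h2
    rw [Real.sq_sqrt (by positivity), ih] at h2
    have hk : (2 * ((k : ℝ) + 1)) ≠ 0 := by positivity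
    apply mul_left_cancel₀ hk
    rw [h2, Nat.factorial_succ, pow_succ]
    push_cast
    field_simp
    ring

/-! ### Hermite functions, wave packets and the Poisson law -/

theorem iteratedDeriv_gauss_eq_hermitePoly (k : ℕ) (x : ℝ) :
    ((iteratedDeriv k (fun y : ℝ => Real.exp (-y ^ 2)) x : ℝ) : ℂ) =
      (-1) ^ k * ((Real.pi ^ (1 / 4 : ℝ) * √(2 ^ k * (k.factorial : ℝ)) : ℝ) : ℂ) *
        (hermitePoly k).eval (x : ℂ) * Complex.exp (-x ^ 2) := by
  induction k generalizing x with
  | zero =>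
    have h : Real.pi ^ (1 / 4 : ℝ) * Real.pi ^ (-1 / 4 : ℝ) = 1 := by
      rw [← Real.rpow_add Real.pi_pos]
      norm_num
    have h' : ((Real.pi ^ (1 / 4 : ℝ) : ℝ) : ℂ) * ((Real.pi ^ (-1 / 4 : ℝ) : ℝ) : ℂ) = 1 := by
      exact_mod_cast h
    simp only [iteratedDeriv_zero, pow_zero, one_mul, Nat.factorial_zero, Nat.cast_one, mul_one,
      Real.sqrt_one, hermitePoly, Polynomial.eval_C]
    rw [h']
    push_cast
    ring
  | succ k ih =>
    obtain ⟨p, hp⟩ := iteratedDeriv_gauss_eq k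
    have hdiff : DifferentiableAt ℝ (iteratedDeriv k (fun y : ℝ => Real.exp (-y ^ 2))) x := by
      rw [hp]
      fun_prop
    have hd := hdiff.hasDerivAt.ofReal_comp
    rw [← iteratedDeriv_succ] at hd
    have h1 : HasDerivAt (fun z : ℂ => (hermitePoly k).eval z * Complex.exp (-z ^ 2))
        ((Polynomial.derivative (hermitePoly k) - 2 * Polynomial.X * hermitePoly k).eval (x : ℂ) *
          Complex.exp (-x ^ 2)) x := by
      have h2 : HasDerivAt (fun z : ℂ => -z ^ 2) (-(2 * x)) (x : ℂ) := by
        refine ((hasDerivAt_pow 2 (x : ℂ)).neg).congr_deriv ?_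
        simp
      refine (((hermitePoly k).hasDerivAt (x : ℂ)).mul h2.cexp).congr_deriv ?_
      simp
      ring
    have h2 := (h1.comp_ofReal).const_mul
      ((-1) ^ k * ((Real.pi ^ (1 / 4 : ℝ) * √(2 ^ k * (k.factorial : ℝ)) : ℝ) : ℂ))
    have h3 := hd.unique (h2.congr_of_eventuallyEq (Filter.Eventually.of_forall fun y => by
      simp only [ih y]
      ring))
    rw [h3, ← neg_sub, ← sqrt_mul_hermitePoly_succ, pow_succ, Nat.factorial_succ]
    have hs : √(2 ^ (k + 1) * (((k + 1) * k.factorial : ℕ) : ℝ)) =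
        √(2 ^ k * (k.factorial : ℝ)) * √(2 * (k + 1 : ℝ)) := by
      rw [← Real.sqrt_mul (by positivity)]
      congr 1
      push_cast
      ring
    rw [hs]
    simp only [Polynomial.eval_neg, Polynomial.eval_mul, Polynomial.eval_C]
    push_cast
    ring

theorem hermiteFun_eq_hermitePoly (k : ℕ) (x : ℝ) :
    (hermiteFun k x : ℂ) = (hermitePoly k).eval (x : ℂ) * Complex.exp (-x ^ 2 / 2) := by
  have h : (0 : ℝ) < Real.pi ^ (1 / 4 : ℝ) * √(2 ^ k * (k.factorial : ℝ)) := by positivity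
  have hc : ((Real.pi ^ (1 / 4 : ℝ) * √(2 ^ k * (k.factorial : ℝ)) : ℝ) : ℂ) ≠ 0 := by
    exact_mod_cast h.ne'
  rw [hermiteFun, physHermite, Complex.ofReal_mul, Complex.ofReal_mul, Complex.ofReal_mul,
    Complex.ofReal_mul, iteratedDeriv_gauss_eq_hermitePoly]
  have he : Complex.exp (x ^ 2) * Complex.exp (-x ^ 2) = 1 := by
    rw [← Complex.exp_add]; simp
  have hs : ((-1 : ℂ) ^ k) * (-1) ^ k = 1 := by
    rw [← mul_pow]; simp
  rw [one_div, Complex.ofReal_inv]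
  set A : ℂ := ((Real.pi ^ (1 / 4 : ℝ) * √(2 ^ k * (k.factorial : ℝ)) : ℝ) : ℂ)
  push_cast
  linear_combination ((hermitePoly k).eval (x : ℂ) * Complex.exp (-x ^ 2 / 2)) *
    (Complex.exp (x ^ 2) * Complex.exp (-x ^ 2) * (-1) ^ k * (-1) ^ k * inv_mul_cancel₀ hc +
      Complex.exp (x ^ 2) * Complex.exp (-x ^ 2) * hs + he)

theorem coeFn_hermiteL2 (k : ℕ) :
    (hermiteL2 k : ℝ → ℂ) =ᵐ[volume] fun x => (hermiteFun k x : ℂ) :=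
  (memLp_hermiteFun k).coeFn_toLp

theorem orthonormal_hermiteL2 : Orthonormal ℂ hermiteL2 := by
  rw [orthonormal_iff_ite]
  intro j k
  rw [L2.inner_def, ← gaussMoment_hermitePoly_mul, gaussMoment]
  refine integral_congr_ae ?_
  filter_upwards [coeFn_hermiteL2 j, coeFn_hermiteL2 k] with x hj hk
  rw [hj, hk, RCLike.inner_apply, Complex.conj_ofReal, hermiteFun_eq_hermitePoly,
    hermiteFun_eq_hermitePoly, Polynomial.eval_mul, zero_mul, add_zero]
  have : Complex.exp (-(x : ℂ) ^ 2) =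
      Complex.exp (-(x : ℂ) ^ 2 / 2) * Complex.exp (-(x : ℂ) ^ 2 / 2) := by
    rw [← Complex.exp_add]
    congr 1
    ring
  rw [this]
  ring

/-- The energy of a wave packet is distributed over the Hermite functions by the Poisson law
with parameter `(s² + η²)/2`. -/
theorem norm_inner_hermiteL2_gaborAtom_sq (k : ℕ) (s η : ℝ) :
    ‖inner ℂ (hermiteL2 k) ((memLp_gaborAtom s η).toLp)‖ ^ 2 =
      √Real.pi * (Real.exp (-((s ^ 2 + η ^ 2) / 2)) *
        (((s ^ 2 + η ^ 2) / 2) ^ k / k.factorial)) := by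
  have h : inner ℂ (hermiteL2 k) ((memLp_gaborAtom s η).toLp) =
      (Real.exp (-s ^ 2 / 2) : ℂ) * gaussMoment (s + η * Complex.I) (hermitePoly k) := by
    rw [L2.inner_def, gaussMoment, ← integral_const_mul]
    refine integral_congr_ae ?_
    filter_upwards [coeFn_hermiteL2 k, (memLp_gaborAtom s η).coeFn_toLp] with x hk ha
    rw [hk, ha, RCLike.inner_apply, Complex.conj_ofReal, hermiteFun_eq_hermitePoly, gaborAtom]
    have : (Real.exp (-(x - s) ^ 2 / 2) : ℂ) * Complex.exp (η * x * Complex.I) *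
        Complex.exp (-(x : ℂ) ^ 2 / 2) =
        (Real.exp (-s ^ 2 / 2) : ℂ) * Complex.exp (-x ^ 2 + (s + η * Complex.I) * x) := by
      rw [Complex.ofReal_exp, Complex.ofReal_exp, ← Complex.exp_add, ← Complex.exp_add,
        ← Complex.exp_add]
      congr 1
      push_cast
      ring
    linear_combination (hermitePoly k).eval (x : ℂ) * this
  have hw : ‖(s + η * Complex.I : ℂ)‖ ^ 2 = s ^ 2 + η ^ 2 := by
    rw [← Complex.normSq_eq_norm_sq, Complex.normSq_add_mul_I]
  have hre : ((s + η * Complex.I : ℂ) ^ 2 / 4).re = (s ^ 2 - η ^ 2) / 4 := by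
    have : ((s + η * Complex.I : ℂ) ^ 2 / 4) =
        (((s ^ 2 - η ^ 2) / 4 : ℝ) : ℂ) + ((s * η / 2 : ℝ) : ℂ) * Complex.I := by
      push_cast
      linear_combination ((η : ℂ) ^ 2 / 4) * Complex.I_sq
    rw [this, Complex.add_re, Complex.ofReal_re, Complex.re_ofReal_mul, Complex.I_re]
    ring
  rw [h, norm_mul, mul_pow, gaussMoment_hermitePoly, hw, Complex.norm_exp, hre,
    Complex.norm_real, Real.norm_eq_abs, Real.abs_exp]
  have : Real.exp (-s ^ 2 / 2) ^ 2 * Real.exp ((s ^ 2 - η ^ 2) / 4) ^ 2 =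
      Real.exp (-((s ^ 2 + η ^ 2) / 2)) := by
    rw [← Real.exp_nat_mul, ← Real.exp_nat_mul, ← Real.exp_add]
    congr 1
    push_cast
    ring
  linear_combination √Real.pi * (((s ^ 2 + η ^ 2) / 2) ^ k / k.factorial) * this

theorem norm_gaborAtom_sq (s η : ℝ) : ‖((memLp_gaborAtom s η).toLp : L2R)‖ ^ 2 = √Real.pi := by
  have h : ‖((memLp_gaborAtom s η).toLp : L2R)‖ₑ ^ 2 = ENNReal.ofReal √Real.pi := by
    rw [← lintegral_enorm_sq_coeFn, ← lintegral_gauss s]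
    refine lintegral_congr_ae ?_
    filter_upwards [(memLp_gaborAtom s η).coeFn_toLp] with x hx
    rw [hx, ← enorm_gauss_sq, gaborAtom, enorm_mul, ← ofReal_norm (Complex.exp _),
      norm_exp_ofReal_mul_mul_I]
    simp
  rw [← ofReal_norm, ← ENNReal.ofReal_pow (norm_nonneg _)] at h
  exact (ENNReal.ofReal_eq_ofReal_iff (by positivity) (by positivity)).1 h

theorem norm_sub_hermiteProj_sq (n : ℕ) (f : L2R) :
    ‖f - hermiteProj n f‖ ^ 2 = ‖f‖ ^ 2 - ‖hermiteProj n f‖ ^ 2 := by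
  have := (hermiteSpan n).norm_sq_eq_add_norm_sq_starProjection f
  rw [Submodule.starProjection_orthogonal_val] at this
  change _ = ‖hermiteProj n f‖ ^ 2 + ‖f - hermiteProj n f‖ ^ 2 at this
  linarith

theorem inner_hermiteProj_left (n : ℕ) (f g : L2R) :
    inner ℂ (hermiteProj n f) g = inner ℂ f (hermiteProj n g) :=
  (hermiteSpan n).inner_starProjection_left_eq_right f g

theorem hermiteProj_hermiteL2 {k n : ℕ} (hk : k ≤ n) :
    hermiteProj n (hermiteL2 k) = hermiteL2 k :=
  Submodule.starProjection_eq_self_iff.2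
    (Submodule.subset_span (Set.mem_image_of_mem _ hk))

/-- Bessel's inequality, applied to the projection of `f`. -/
theorem sum_norm_inner_hermiteL2_sq_le (n : ℕ) (f : L2R) :
    ∑ k ∈ Finset.range (n + 1), ‖inner ℂ (hermiteL2 k) f‖ ^ 2 ≤ ‖hermiteProj n f‖ ^ 2 := by
  refine le_trans (le_of_eq ?_)
    (orthonormal_hermiteL2.sum_inner_products_le (hermiteProj n f) (s := Finset.range (n + 1)))
  refine Finset.sum_congr rfl fun k hk => ?_
  rw [← inner_hermiteProj_left, hermiteProj_hermiteL2 (Nat.lt_succ_iff.1 (Finset.mem_range.1 hk))]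

/-- Chernoff's bound for the Poisson tail beyond `n`, with tilting factor `4/3`. -/
theorem poisson_tail_le {l : ℝ} (hl : 0 ≤ l) (n : ℕ) :
    1 - ∑ k ∈ Finset.range (n + 1), Real.exp (-l) * (l ^ k / k.factorial) ≤
      (3 / 4) ^ (n + 1) * Real.exp (l / 3) := by
  have hs : ∀ y : ℝ, HasSum (fun k : ℕ => y ^ k / k.factorial) (Real.exp y) := fun y => by
    rw [Real.exp_eq_exp_ℝ]
    exact NormedSpace.expSeries_div_hasSum_exp y
  have h1 : Real.exp l - ∑ k ∈ Finset.range (n + 1), l ^ k / k.factorial =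
      ∑' k : ℕ, l ^ (k + (n + 1)) / (k + (n + 1)).factorial := by
    rw [← (hs l).tsum_eq, ← (hs l).summable.sum_add_tsum_nat_add (n + 1)]
    ring
  have h2 : ∑' k : ℕ, l ^ (k + (n + 1)) / (k + (n + 1)).factorial ≤
      (3 / 4) ^ (n + 1) * Real.exp (4 / 3 * l) := by
    have hsum : Summable fun k : ℕ => (4 / 3 * l) ^ (k + (n + 1)) / (k + (n + 1)).factorial :=
      (summable_nat_add_iff (f := fun k : ℕ => (4 / 3 * l) ^ k / k.factorial) (n + 1)).2
        (hs _).summable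
    calc _ ≤ ∑' k : ℕ, (3 / 4) ^ (n + 1) *
          ((4 / 3 * l) ^ (k + (n + 1)) / (k + (n + 1)).factorial) := by
          refine Summable.tsum_le_tsum (fun k => ?_)
            ((summable_nat_add_iff (f := fun k : ℕ => l ^ k / k.factorial) (n + 1)).2
              (hs l).summable) (hsum.mul_left _)
          rw [← mul_div_assoc]
          gcongr
          -- Every index here exceeds `n`, so at least `n + 1` of the factors `4/3` are available.
          have e : (3 / 4 : ℝ) ^ (n + 1) * (4 / 3 * l) ^ (k + (n + 1)) =
              (4 / 3) ^ k * l ^ (k + (n + 1)) := by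
            have : (3 / 4 : ℝ) ^ (n + 1) * (4 / 3) ^ (n + 1) = 1 := by
              rw [← mul_pow]; norm_num
            rw [mul_pow, pow_add (4 / 3 : ℝ)]
            linear_combination (4 / 3 : ℝ) ^ k * l ^ (k + (n + 1)) * this
          rw [e]
          exact le_mul_of_one_le_left (by positivity) (one_le_pow₀ (by norm_num))
      _ ≤ _ := by
          rw [tsum_mul_left]
          gcongr
          rw [← (hs (4 / 3 * l)).tsum_eq]
          rw [← (hs (4 / 3 * l)).summable.sum_add_tsum_nat_add (n + 1)]
          exact le_add_of_nonneg_left (Finset.sum_nonneg fun k _ => by positivity)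
  rw [← Finset.mul_sum]
  have h3 : Real.exp (-l) * Real.exp l = 1 := by rw [← Real.exp_add]; simp
  have h4 : Real.exp (-l) * Real.exp (4 / 3 * l) = Real.exp (l / 3) := by
    rw [← Real.exp_add]
    congr 1
    ring
  have h5 := mul_le_mul_of_nonneg_left (h1.trans_le h2) (Real.exp_pos (-l)).le
  calc _ = Real.exp (-l) * (Real.exp l - ∑ k ∈ Finset.range (n + 1), l ^ k / k.factorial) := by
        rw [mul_sub, h3]
    _ ≤ _ := h5
    _ = _ := by rw [← h4]; ring

theorem norm_gaborAtom_sub_hermiteProj_sq_le (n : ℕ) (s η : ℝ) :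
    ‖(memLp_gaborAtom s η).toLp - hermiteProj n ((memLp_gaborAtom s η).toLp)‖ ^ 2 ≤
      √Real.pi * ((3 / 4) ^ (n + 1) * Real.exp ((s ^ 2 + η ^ 2) / 2 / 3)) := by
  rw [norm_sub_hermiteProj_sq, norm_gaborAtom_sq]
  have h1 := sum_norm_inner_hermiteL2_sq_le n ((memLp_gaborAtom s η).toLp)
  simp_rw [norm_inner_hermiteL2_gaborAtom_sq] at h1
  rw [← Finset.mul_sum] at h1
  have h2 := mul_le_mul_of_nonneg_left
    (poisson_tail_le (l := (s ^ 2 + η ^ 2) / 2) (by positivity) n) (Real.sqrt_nonneg Real.pi)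
  linarith

/-! ### The phase space estimate -/

theorem lintegral_prod_gabor (f : L2R) :
    ∫⁻ z : ℝ × ℝ, ‖gabor f z.1 z.2‖ₑ ^ 2 =
      ENNReal.ofReal (2 * Real.pi * √Real.pi * ‖f‖ ^ 2) := by
  rw [← lintegral_gabor_coeFn, Measure.volume_eq_prod, lintegral_prod]
  exact ((measurable_gabor f).enorm.pow_const 2).aemeasurable

theorem enorm_sq_eq_ofReal (w : ℂ) : ‖w‖ₑ ^ 2 = ENNReal.ofReal (‖w‖ ^ 2) := by
  rw [ENNReal.ofReal_pow (norm_nonneg _), ofReal_norm]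

theorem integrable_norm_gabor_sq (f : L2R) :
    Integrable fun z : ℝ × ℝ => ‖gabor f z.1 z.2‖ ^ 2 := by
  refine ⟨((measurable_gabor f).norm.pow 2).aestronglyMeasurable, ?_⟩
  have h := lintegral_prod_gabor f
  simp_rw [enorm_sq_eq_ofReal] at h
  rw [hasFiniteIntegral_iff_ofReal (Filter.Eventually.of_forall fun z => by positivity), h]
  exact ENNReal.ofReal_lt_top

theorem ofReal_setIntegral_norm_gabor_sq (f : L2R) (S : Set (ℝ × ℝ)) :
    ENNReal.ofReal (∫ z in S, ‖gabor f z.1 z.2‖ ^ 2) = ∫⁻ z in S, ‖gabor f z.1 z.2‖ₑ ^ 2 := by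
  simp_rw [enorm_sq_eq_ofReal]
  exact ofReal_integral_eq_lintegral_ofReal (integrable_norm_gabor_sq f).integrableOn
    (Filter.Eventually.of_forall fun z => by positivity)

theorem integral_norm_gabor_sq (f : L2R) :
    ∫ z : ℝ × ℝ, ‖gabor f z.1 z.2‖ ^ 2 = 2 * Real.pi * √Real.pi * ‖f‖ ^ 2 := by
  have h := ofReal_setIntegral_norm_gabor_sq f Set.univ
  rw [Measure.restrict_univ, lintegral_prod_gabor] at h
  exact (ENNReal.ofReal_eq_ofReal_iff (integral_nonneg fun z => by positivity)
    (by positivity)).1 h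

theorem setIntegral_gabor_time_tail_le (f : L2R) {ε P T : ℝ} (hPT : T < P)
    (hf : AlmostTimeLimited f ε T) :
    ∫ z in {s : ℝ | P < |s|} ×ˢ (Set.univ : Set ℝ), ‖gabor f z.1 z.2‖ ^ 2 ≤
      2 * Real.pi * √Real.pi * ((ε ^ 2 + 1 / (2 * (P - T) ^ 2)) * ‖f‖ ^ 2) := by
  refine (ENNReal.ofReal_le_ofReal_iff (by positivity)).1 ?_
  rw [ofReal_setIntegral_norm_gabor_sq, Measure.volume_eq_prod, ← Measure.prod_restrict,
    Measure.restrict_univ,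
    lintegral_prod _ ((measurable_gabor f).enorm.pow_const 2).aemeasurable]
  exact lintegral_gabor_time_tail f hPT hf

theorem setIntegral_gabor_frequency_tail_le (f : L2R) {ε P Ω : ℝ} (hPΩ : Ω < P)
    (hf : AlmostBandLimited f ε Ω) :
    ∫ z in (Set.univ : Set ℝ) ×ˢ {η : ℝ | P < |η|}, ‖gabor f z.1 z.2‖ ^ 2 ≤
      2 * Real.pi * √Real.pi * ((ε ^ 2 + 1 / (2 * (P - Ω) ^ 2)) * ‖f‖ ^ 2) := by
  refine (ENNReal.ofReal_le_ofReal_iff (by positivity)).1 ?_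
  rw [ofReal_setIntegral_norm_gabor_sq, Measure.volume_eq_prod, ← Measure.prod_restrict,
    Measure.restrict_univ,
    lintegral_prod_symm _ ((measurable_gabor f).enorm.pow_const 2).aemeasurable]
  exact lintegral_gabor_frequency_tail f hPΩ hf

theorem inner_sub_hermiteProj_right (n : ℕ) (f g : L2R) :
    inner ℂ g (f - hermiteProj n f) = inner ℂ (g - hermiteProj n g) (f - hermiteProj n f) := by
  have h : inner ℂ (hermiteProj n g) (f - hermiteProj n f) = 0 := by
    rw [inner_hermiteProj_left, map_sub]
    have : hermiteProj n (hermiteProj n f) = hermiteProj n f :=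
      Submodule.starProjection_eq_self_iff.2 ((hermiteSpan n).starProjection_apply_mem f)
    rw [this, sub_self, inner_zero_right]
  rw [inner_sub_left, h, sub_zero]

theorem norm_gabor_sub_hermiteProj_sq_le (n : ℕ) (f : L2R) (s η : ℝ) :
    ‖gabor (f - hermiteProj n f : L2R) s η‖ ^ 2 ≤
      √Real.pi * ((3 / 4) ^ (n + 1) * Real.exp ((s ^ 2 + η ^ 2) / 2 / 3)) *
        ‖f - hermiteProj n f‖ ^ 2 := by
  rw [gabor_eq_inner, inner_sub_hermiteProj_right]
  refine (pow_le_pow_left₀ (norm_nonneg _) (norm_inner_le_norm _ _) 2).trans ?_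
  rw [mul_pow]
  gcongr
  exact norm_gaborAtom_sub_hermiteProj_sq_le n s η

theorem gabor_add (f g : L2R) (s η : ℝ) :
    gabor (f + g : L2R) s η = gabor f s η + gabor g s η := by
  simp_rw [gabor_eq_inner, inner_add_right]

/-- Evaluates `Re ⟪f, f - K_n f⟫ = ‖f - K_n f‖²` through a norm, so that only the norm form of the
Moyal identity is needed. -/
theorem norm_add_sub_hermiteProj_sq (n : ℕ) (f : L2R) :
    ‖f + (f - hermiteProj n f)‖ ^ 2 = ‖f‖ ^ 2 + 3 * ‖f - hermiteProj n f‖ ^ 2 := by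
  rw [@norm_add_sq ℂ, inner_sub_hermiteProj_right, inner_self_eq_norm_sq]
  ring

theorem setIntegral_gabor_sub_hermiteProj_square_le (n : ℕ) (f : L2R) {P : ℝ} (hP : 0 ≤ P)
    (hPn : P ^ 2 ≤ 3 / 4 * n) :
    ∫ z in Set.Icc (-P) P ×ˢ Set.Icc (-P) P, ‖gabor (f - hermiteProj n f : L2R) z.1 z.2‖ ^ 2 ≤
      3 * √Real.pi * n * ((3 / 4) ^ n * Real.exp (n / 4)) * ‖f - hermiteProj n f‖ ^ 2 := by
  set g := f - hermiteProj n f with hg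
  have hv : volume.real (Set.Icc (-P) P ×ˢ Set.Icc (-P) P) = 4 * P ^ 2 := by
    rw [Measure.volume_eq_prod, measureReal_prod_prod, Real.volume_real_Icc_of_le (by linarith)]
    ring
  have hb := norm_setIntegral_le_of_norm_le_const (μ := volume)
    (s := Set.Icc (-P) P ×ˢ Set.Icc (-P) P)
    (f := fun z : ℝ × ℝ => ‖gabor g z.1 z.2‖ ^ 2)
    (C := √Real.pi * ((3 / 4) ^ n * Real.exp (n / 4)) * ‖g‖ ^ 2)
    ((isCompact_Icc.prod isCompact_Icc).measure_lt_top) (fun z hz => by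
      rw [Real.norm_eq_abs, abs_of_nonneg (by positivity)]
      refine (norm_gabor_sub_hermiteProj_sq_le n f z.1 z.2).trans ?_
      have h1 : z.1 ^ 2 ≤ P ^ 2 := sq_le_sq' hz.1.1 hz.1.2
      have h2 : z.2 ^ 2 ≤ P ^ 2 := sq_le_sq' hz.2.1 hz.2.2
      gcongr √Real.pi * (?_ * Real.exp ?_) * _
      · exact pow_le_pow_of_le_one (by norm_num) (by norm_num) (Nat.le_succ n)
      · linarith)
  refine (le_abs_self _).trans (hb.trans ?_)
  rw [hv]
  calc _ ≤ √Real.pi * ((3 / 4) ^ n * Real.exp (n / 4)) * ‖g‖ ^ 2 * (4 * (3 / 4 * n)) := by gcongr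
    _ = _ := by ring

/-- The phase space estimate. The cross term `2 |V f| |V (f - K_n f)|` is split unevenly: outside
the square `[-P, P]²` it is at most `|V f|² + |V (f - K_n f)|²`, where `V f` is small; inside it is at
most `σ |V f|² + σ⁻¹ |V (f - K_n f)|²`, where `V (f - K_n f)` is exponentially small. -/
theorem norm_sub_hermiteProj_sq_le {f : L2R} {εT εΩ T Ω P σ : ℝ} (n : ℕ)
    (hfT : AlmostTimeLimited f εT T) (hfΩ : AlmostBandLimited f εΩ Ω)
    (hP : 0 ≤ P) (hPn : P ^ 2 ≤ 3 / 4 * n) (hT : T < P) (hΩ : Ω < P) (hσ : 0 < σ) :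
    ‖f - hermiteProj n f‖ ^ 2 ≤
      (εT ^ 2 + εΩ ^ 2 + 1 / (2 * (P - T) ^ 2) + 1 / (2 * (P - Ω) ^ 2) + σ) * ‖f‖ ^ 2 +
        σ⁻¹ * (n / 2 * ((3 / 4) ^ n * Real.exp (n / 4))) * ‖f - hermiteProj n f‖ ^ 2 := by
  set g := f - hermiteProj n f with hg
  set A : Set (ℝ × ℝ) := {s : ℝ | P < |s|} ×ˢ (Set.univ : Set ℝ)
  set B : Set (ℝ × ℝ) := (Set.univ : Set ℝ) ×ˢ {η : ℝ | P < |η|}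
  set Q : Set (ℝ × ℝ) := Set.Icc (-P) P ×ˢ Set.Icc (-P) P
  have hms : MeasurableSet {s : ℝ | P < |s|} := measurableSet_lt measurable_const measurable_norm
  have hA : MeasurableSet A := hms.prod MeasurableSet.univ
  have hB : MeasurableSet B := MeasurableSet.univ.prod hms
  have hQ : MeasurableSet Q := measurableSet_Icc.prod measurableSet_Icc
  set F : ℝ × ℝ → ℝ := fun z => ‖gabor f z.1 z.2‖ ^ 2 with hF
  set G : ℝ × ℝ → ℝ := fun z => ‖gabor g z.1 z.2‖ ^ 2 with hG
  have iF : Integrable F := integrable_norm_gabor_sq f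
  have iG : Integrable G := integrable_norm_gabor_sq g
  have hpt : ∀ z : ℝ × ℝ, ‖gabor (f + g : L2R) z.1 z.2‖ ^ 2 ≤
      (1 + σ) * F z + 2 * G z + A.indicator F z + B.indicator F z + σ⁻¹ * Q.indicator G z := by
    intro z
    have hF0 : 0 ≤ F z := by positivity
    have hG0 : 0 ≤ G z := by positivity
    have hA0 : 0 ≤ A.indicator F z := Set.indicator_apply_nonneg fun _ => hF0
    have hB0 : 0 ≤ B.indicator F z := Set.indicator_apply_nonneg fun _ => hF0
    have h1 : ‖gabor (f + g : L2R) z.1 z.2‖ ^ 2 ≤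
        F z + G z + 2 * (‖gabor f z.1 z.2‖ * ‖gabor g z.1 z.2‖) := by
      rw [gabor_add]
      refine (pow_le_pow_left₀ (norm_nonneg _) (norm_add_le _ _) 2).trans_eq ?_
      simp only [hF, hG]
      ring
    by_cases hz : z ∈ Q
    · rw [Set.indicator_of_mem hz]
      have h2 : 2 * (‖gabor f z.1 z.2‖ * ‖gabor g z.1 z.2‖) ≤ σ * F z + σ⁻¹ * G z := by
        have h3 : 0 ≤ σ⁻¹ * (σ * ‖gabor f z.1 z.2‖ - ‖gabor g z.1 z.2‖) ^ 2 := by positivity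
        have h4 : σ⁻¹ * (σ * ‖gabor f z.1 z.2‖ - ‖gabor g z.1 z.2‖) ^ 2 =
            σ * F z + σ⁻¹ * G z - 2 * (‖gabor f z.1 z.2‖ * ‖gabor g z.1 z.2‖) := by
          simp only [hF, hG]
          field_simp
          ring
        linarith
      linarith
    · rw [Set.indicator_of_notMem hz]
      have h2 : 2 * (‖gabor f z.1 z.2‖ * ‖gabor g z.1 z.2‖) ≤ F z + G z := by
        simp only [hF, hG]
        nlinarith [sq_nonneg (‖gabor f z.1 z.2‖ - ‖gabor g z.1 z.2‖)]
      have h3 : F z ≤ A.indicator F z + B.indicator F z := by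
        by_cases hzA : z ∈ A
        · rw [Set.indicator_of_mem hzA]
          linarith
        · have hzB : z ∈ B := by
            refine ⟨trivial, ?_⟩
            by_contra hn
            refine hz ⟨abs_le.1 (not_lt.1 fun h => hzA ⟨h, trivial⟩), abs_le.1 (not_lt.1 hn)⟩
          rw [Set.indicator_of_mem hzB]
          linarith
      have h4 : 0 ≤ σ * F z := by positivity
      linarith
  have i1 : Integrable fun z => (1 + σ) * F z := iF.const_mul _
  have i2 : Integrable fun z => 2 * G z := iG.const_mul _
  have i3 : Integrable fun z => A.indicator F z := iF.indicator hA
  have i4 : Integrable fun z => B.indicator F z := iF.indicator hB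
  have i5 : Integrable fun z => σ⁻¹ * Q.indicator G z := (iG.indicator hQ).const_mul _
  have hI := integral_mono (integrable_norm_gabor_sq (f + g))
    ((((i1.add i2).add i3).add i4).add i5) hpt
  have i12 : Integrable fun z => (1 + σ) * F z + 2 * G z := i1.add i2
  have i123 : Integrable fun z => (1 + σ) * F z + 2 * G z + A.indicator F z := i12.add i3
  have i1234 : Integrable fun z =>
    (1 + σ) * F z + 2 * G z + A.indicator F z + B.indicator F z := i123.add i4
  have hsplit : ∫ z, ((1 + σ) * F z + 2 * G z + A.indicator F z + B.indicator F z +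
      σ⁻¹ * Q.indicator G z) = (1 + σ) * (∫ z, F z) + 2 * (∫ z, G z) + (∫ z in A, F z) +
        (∫ z in B, F z) + σ⁻¹ * ∫ z in Q, G z := by
    rw [integral_add i1234 i5, integral_add i123 i4, integral_add i12 i3, integral_add i1 i2,
      integral_const_mul, integral_const_mul, integral_const_mul, integral_indicator hA,
      integral_indicator hB, integral_indicator hQ]
  have hI' := hI.trans_eq hsplit
  rw [integral_norm_gabor_sq, norm_add_sub_hermiteProj_sq, integral_norm_gabor_sq,
    integral_norm_gabor_sq] at hI'
  have hAt := setIntegral_gabor_time_tail_le f hT hfT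
  have hBt := setIntegral_gabor_frequency_tail_le f hΩ hfΩ
  have hQt := mul_le_mul_of_nonneg_left
    (setIntegral_gabor_sub_hermiteProj_square_le n f hP hPn) (inv_pos.2 hσ).le
  have hc : 0 < 2 * Real.pi * √Real.pi := by positivity
  have hD : σ⁻¹ * (3 * √Real.pi * n * ((3 / 4) ^ n * Real.exp (n / 4)) * ‖g‖ ^ 2) ≤
      2 * Real.pi * √Real.pi *
        (σ⁻¹ * (n / 2 * ((3 / 4) ^ n * Real.exp (n / 4))) * ‖g‖ ^ 2) := by
    have : 0 ≤ √Real.pi * (σ⁻¹ * (n * ((3 / 4) ^ n * Real.exp (n / 4))) * ‖g‖ ^ 2) := by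
      positivity
    nlinarith [mul_le_mul_of_nonneg_right Real.pi_gt_three.le this]
  refine le_of_mul_le_mul_left ?_ hc
  linarith

/-- Numerically `(3/4) e^{1/4} ≤ e^{-1/30}`, and `e^{n/30}` dominates its cubic Taylor term. -/
theorem cube_mul_pow_mul_exp_le (n : ℕ) :
    (n : ℝ) ^ 3 * ((3 / 4) ^ n * Real.exp (n / 4)) ≤ 162000 := by
  have h1 : Real.exp (17 / 60) ≤ 4 / 3 := by
    refine le_of_pow_le_pow_left₀ (n := 60) (by norm_num) (by norm_num) ?_
    rw [← Real.exp_nat_mul]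
    have : ((60 : ℕ) : ℝ) * (17 / 60) = ((17 : ℕ) : ℝ) * 1 := by norm_num
    rw [this, Real.exp_nat_mul]
    exact (pow_le_pow_left₀ (Real.exp_pos 1).le Real.exp_one_lt_d9.le 17).trans (by norm_num)
  have h2 : (3 / 4 : ℝ) ^ n * Real.exp (17 / 60 * n) ≤ 1 := by
    rw [mul_comm (17 / 60 : ℝ), Real.exp_nat_mul, ← mul_pow]
    exact pow_le_one₀ (by positivity) (by linarith)
  have h3 := Real.pow_div_factorial_le_exp ((n : ℝ) / 30) (by positivity) 3
  have h4 : Real.exp ((n : ℝ) / 30) * Real.exp (n / 4) = Real.exp (17 / 60 * n) := by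
    rw [← Real.exp_add]
    congr 1
    ring
  have h5 : (n : ℝ) ^ 3 ≤ 162000 * Real.exp ((n : ℝ) / 30) := by
    have : ((n : ℝ) / 30) ^ 3 / (Nat.factorial 3 : ℝ) = n ^ 3 / 162000 := by
      rw [show Nat.factorial 3 = 6 from rfl]
      push_cast
      ring
    rw [this, div_le_iff₀ (by norm_num)] at h3
    linarith
  calc _ ≤ 162000 * Real.exp ((n : ℝ) / 30) * ((3 / 4) ^ n * Real.exp (n / 4)) := by gcongr
    _ = 162000 * ((3 / 4) ^ n * Real.exp (17 / 60 * n)) := by rw [← h4]; ring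
    _ ≤ 162000 * 1 := by gcongr
    _ = _ := mul_one _

/-- The half-side `P = 0.866 √n` is just below `√(3n)/2`, as the Chernoff bound needs, and exceeds
`√(n/2)`, the largest admissible `T` or `Ω₀`, by a fixed multiple of `√n`. -/
theorem one_div_gap_sq_le {n T : ℝ} (hn : 0 < n) (hT : 2 * T ^ 2 ≤ n) :
    T < 433 / 500 * √n ∧ 1 / (2 * (433 / 500 * √n - T) ^ 2) ≤ 23 / n := by
  have hr : 0 < √n := Real.sqrt_pos.2 hn
  have hr2 : √n ^ 2 = n := Real.sq_sqrt hn.le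
  have h1 : T ≤ 177 / 250 * √n := by
    refine le_of_sq_le_sq ?_ (by positivity)
    rw [mul_pow, hr2]
    linarith
  have h2 : 79 / 500 * √n ≤ 433 / 500 * √n - T := by linarith
  refine ⟨by linarith, ?_⟩
  have h3 : (79 / 500) ^ 2 * n ≤ (433 / 500 * √n - T) ^ 2 := by
    calc (79 / 500) ^ 2 * n = (79 / 500 * √n) ^ 2 := by rw [mul_pow, hr2]
      _ ≤ _ := pow_le_pow_left₀ (by positivity) h2 2
  rw [div_le_div_iff₀ (by nlinarith) hn]
  linarith

theorem mainTheorem1 (T₀ Ω₀ εT εΩ : ℝ) (hT₀ : 2 ≤ T₀) (hΩ₀ : 2 ≤ Ω₀)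
    (hεT : 0 < εT) (hεΩ : 0 < εΩ) (f : L2R)
    (hfT : AlmostTimeLimited f εT T₀) (hfΩ : AlmostBandLimited f εΩ Ω₀)
    (T : ℝ) (hT : T₀ ≤ T) (n : ℕ) (hn : max (2 * T ^ 2) (2 * Ω₀ ^ 2) ≤ (n : ℝ)) :
    MeasureTheory.eLpNorm (f - hermiteProj n f : L2R) 2 (MeasureTheory.volume.restrict (Set.Icc (-T) T)) ≤
      ENNReal.ofReal ((2 * εT + εΩ + 34 * T ^ 3 / √(2 * (n : ℝ) + 1)) * ‖f‖) := by
  have hT2 : 2 ≤ T := hT₀.trans hT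
  have hnT : 2 * T ^ 2 ≤ (n : ℝ) := (le_max_left _ _).trans hn
  have hn1 : (1 : ℝ) ≤ n := by nlinarith
  have hn0 : (0 : ℝ) < n := by linarith
  obtain ⟨hPT, hgT⟩ := one_div_gap_sq_le (T := T₀) hn0 (by nlinarith)
  obtain ⟨hPΩ, hgΩ⟩ := one_div_gap_sq_le (T := Ω₀) hn0 ((le_max_right _ _).trans hn)
  -- With `σ = 300 / n` both terms that depend on `σ` are of order `1 / n`.
  have key := norm_sub_hermiteProj_sq_le (σ := 300 / n) n hfT hfΩ (by positivity)
    (by rw [mul_pow, Real.sq_sqrt hn0.le]; linarith) hPT hPΩ (by positivity)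
  set P := 433 / 500 * √(n : ℝ)
  set D := (3 / 4 : ℝ) ^ n * Real.exp (n / 4)
  have hle : ‖f - hermiteProj n f‖ ^ 2 ≤ ‖f‖ ^ 2 := by
    rw [norm_sub_hermiteProj_sq]
    linarith [sq_nonneg ‖hermiteProj n f‖]
  have hD : (300 / (n : ℝ))⁻¹ * (n / 2 * D) ≤ 270 / n := by
    have h := cube_mul_pow_mul_exp_le n
    have e : (300 / (n : ℝ))⁻¹ * (n / 2 * D) = n ^ 3 * D / (600 * n) := by
      field_simp
      ring
    rw [e, div_le_div_iff₀ (by positivity) hn0]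
    nlinarith
  set η := 34 * T ^ 3 / √(2 * (n : ℝ) + 1) with hη
  have hη0 : 0 ≤ η := by positivity
  -- `616 = 23 + 23 + 300 + 270` collects all errors of order `1 / n`.
  have hη2 : 616 / n ≤ η ^ 2 := by
    rw [hη, div_pow, Real.sq_sqrt (by positivity), div_le_div_iff₀ hn0 (by positivity)]
    have h8 : (8 : ℝ) ≤ T ^ 3 := by
      have := pow_le_pow_left₀ (by norm_num) hT2 3
      linarith
    have h9 : (73984 : ℝ) ≤ (34 * T ^ 3) ^ 2 := by nlinarith
    nlinarith
  have hsq : ‖f - hermiteProj n f‖ ^ 2 ≤ ((2 * εT + εΩ + η) * ‖f‖) ^ 2 := by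
    have h1 : (300 / (n : ℝ))⁻¹ * (n / 2 * D) * ‖f - hermiteProj n f‖ ^ 2 ≤
        270 / n * ‖f‖ ^ 2 := by gcongr
    have h2 : εT ^ 2 + εΩ ^ 2 + 1 / (2 * (P - T₀) ^ 2) + 1 / (2 * (P - Ω₀) ^ 2) + 300 / n +
        270 / n ≤ (2 * εT + εΩ + η) ^ 2 := by
      have e : (616 : ℝ) / n = 23 / n + 23 / n + 300 / n + 270 / n := by ring
      nlinarith [mul_pos hεT hεΩ, mul_nonneg hεT.le hη0, mul_nonneg hεΩ.le hη0]
    rw [mul_pow]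
    have h3 := mul_le_mul_of_nonneg_right h2 (sq_nonneg ‖f‖)
    linarith
  -- The bound holds for the norm over the whole line.
  refine (eLpNorm_mono_measure _ Measure.restrict_le_self).trans ?_
  rw [← Lp.enorm_def, ← ofReal_norm]
  exact ENNReal.ofReal_le_ofReal (le_of_sq_le_sq hsq (by positivity))

end
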